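/- Let $\rho,\sigma$ be quantum states on a finite-dimensional complex Hilbert space (positive semidefinite operators of unit trace), and let $f:(0,\infty)\to\mathbb R$ be convex and twice differentiable with $f(1)=0$. For $\gamma\ge 0$ let $E_\gamma(\rho\|\sigma)=\operatorname{Tr}(\rho-\gamma\sigma)_+$, where $X_+$ is the positive part of a Hermitian operator $X$, and define $$D_f(\rho\|\sigma)=\int_1^\infty\Big(f''(\gamma)E_\gamma(\rho\|\sigma)+\gamma^{-3}f''(\gamma^{-1})E_\gamma(\sigma\|\rho)\Big)\,d\gamma\in[0,\infty],\qquad \chi^2(\rho\|\sigma)=D_{x^2-1}(\rho\|\sigma).$$ Let $D_{\max}(\rho\|\sigma)=\inf\{x\in\mathbb R:\rho\le e^{x}\sigma\}$ (with $\inf\emptyset=+\infty$), let $I=[e^{-D_{\max}(\sigma\|\rho)},e^{D_{\max}(\rho\|\sigma)}]\cap(0,\infty)$, and define in $[0,\infty]$ $$\kappa^\uparrow_f=\sup_{t\in[0,1],\,\gamma\in I}f''(1+t(\gamma-1)),\qquad \kappa^\downarrow_f=\inf_{t\in[0,1],\,\gamma\in I}f''(1+t(\gamma-1))$$ (these are the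 maximum and the minimum whenever those are attained, for instance if $f''$ is continuous and $\rho,\sigma$ have the same support). Let $\lambda_{\min}(\sigma)$ be the smallest eigenvalue of $\sigma$. Then $$\frac{\kappa^\downarrow_f}{2}\,\chi^2(\rho\|\sigma)\le D_f(\rho\|\sigma)\le\frac{\kappa^\uparrow_f}{2}\,\chi^2(\rho\|\sigma)$$ and $$D_f(\rho\|\sigma)\le\frac{2\,\kappa^\uparrow_f}{\lambda_{\min}(\sigma)}\,E_1(\rho\|\sigma)^2 .$$ All quantities are taken in $[0,\infty]$, with the conventions $0\cdot\infty=0$, $a/0=\infty$ for $a>0$, and $0/0=0$; the last right-hand side is read as the quotient of $2\kappa^\uparrow_f E_1(\rho\|\sigma)^2$ by $\lambda_{\min}(\sigma)$. -/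

import Mathlib

open scoped ENNReal ComplexOrder

noncomputable section

namespace QDiv

variable {n : Type*} [Fintype n] [DecidableEq n]

/-- Quantum states on `ℂⁿ`: positive semidefinite complex matrices of unit trace. -/
structure IsState (ρ : Matrix n n ℂ) : Prop where
  posSemidef : ρ.PosSemidef
  trace_eq_one : ρ.trace = 1

/-- The class `ℱ` of functions on `(0, ∞)` that are convex and twice differentiable, with
`f 1 = 0`. Values of `f` outside `(0, ∞)` play no role anywhere below. -/
structure MemF (f : ℝ → ℝ) : Prop where
  convexOn : ConvexOn ℝ (Set.Ioi 0) f
  differentiableOn : DifferentiableOn ℝ f (Set.Ioi 0)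
  differentiableOn_deriv : DifferentiableOn ℝ (deriv f) (Set.Ioi 0)
  map_one : f 1 = 0

/-- The positive part `X₊` in the eigendecomposition of a Hermitian matrix `X`, i.e. the
function `x ↦ max x 0` applied to `X` in the functional calculus. -/
def matPosPart (X : Matrix n n ℂ) : Matrix n n ℂ :=
  cfc (fun x : ℝ => max x 0) X

/-- The hockey-stick divergence `E_γ(ρ‖σ) = Tr (ρ - γ σ)₊`. -/
def hockeyStick (γ : ℝ) (ρ σ : Matrix n n ℂ) : ℝ :=
  (matPosPart (ρ - γ • σ)).trace.re

/-- The `f`-divergence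
`D_f(ρ‖σ) = ∫_1^∞ (f''(γ) E_γ(ρ‖σ) + γ⁻³ f''(γ⁻¹) E_γ(σ‖ρ)) dγ`.
For `f ∈ ℱ` and states `ρ, σ` the integrand is nonnegative (`f'' ≥ 0` by convexity), so the
integral always exists as an element of `[0, ∞]`. -/
def fDiv (f : ℝ → ℝ) (ρ σ : Matrix n n ℂ) : ℝ≥0∞ :=
  ∫⁻ γ in Set.Ioi (1 : ℝ), ENNReal.ofReal
    (deriv (deriv f) γ * hockeyStick γ ρ σ +
      (γ ^ 3)⁻¹ * deriv (deriv f) γ⁻¹ * hockeyStick γ σ ρ)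

/-- The Hellinger divergence `H_α = D_{f_α}` with `f_α(x) = (x ^ α - 1) / (α - 1)`, used for
`α > 1`. -/
def hellinger (α : ℝ) (ρ σ : Matrix n n ℂ) : ℝ≥0∞ :=
  fDiv (fun x : ℝ => (x ^ α - 1) / (α - 1)) ρ σ

/-- The chi-square divergence `χ²(ρ‖σ) = H_2(ρ‖σ)`. -/
def chiSq (ρ σ : Matrix n n ℂ) : ℝ≥0∞ := hellinger 2 ρ σ

/-- The max-relative entropy `D_max(ρ‖σ) = inf {x ∈ ℝ | ρ ≤ e^x σ}` in the Löwner order; it is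
`+∞` when there is no such `x`. -/
def dMax (ρ σ : Matrix n n ℂ) : EReal :=
  sInf {y : EReal | ∃ x : ℝ, y = (x : EReal) ∧ (Real.exp x • σ - ρ).PosSemidef}

/-- The interval `[e^{-D_max(σ‖ρ)}, e^{D_max(ρ‖σ)}]`, intersected with the domain `(0, ∞)` of
the functions in `ℱ`. The intersection matters only when `D_max(σ‖ρ) = ∞` or
`D_max(ρ‖σ) = ∞`, where an endpoint is `0` or `∞`. -/
def ratioInterval (ρ σ : Matrix n n ℂ) : Set ℝ :=
  {γ : ℝ | 0 < γ ∧ EReal.exp (-dMax σ ρ) ≤ ENNReal.ofReal γ ∧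
    ENNReal.ofReal γ ≤ EReal.exp (dMax ρ σ)}

/-- `κ↑_f(ρ,σ)`: the supremum of `f''(1 + t (γ - 1))` over `t ∈ [0,1]` and `γ` in the interval,
in `[0, ∞]`; it is the maximum whenever that is attained. -/
def kappaUp (f : ℝ → ℝ) (ρ σ : Matrix n n ℂ) : ℝ≥0∞ :=
  ⨆ t ∈ Set.Icc (0 : ℝ) 1, ⨆ γ ∈ ratioInterval ρ σ,
    ENNReal.ofReal (deriv (deriv f) (1 + t * (γ - 1)))

/-- `κ↓_f(ρ,σ)`: the infimum of `f''(1 + t (γ - 1))` over `t ∈ [0,1]` and `γ` in the interval;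
it is the minimum whenever that is attained. -/
def kappaDown (f : ℝ → ℝ) (ρ σ : Matrix n n ℂ) : ℝ≥0∞ :=
  ⨅ t ∈ Set.Icc (0 : ℝ) 1, ⨅ γ ∈ ratioInterval ρ σ,
    ENNReal.ofReal (deriv (deriv f) (1 + t * (γ - 1)))

/-- The smallest eigenvalue of a Hermitian matrix. -/
def lambdaMin (X : Matrix n n ℂ) : ℝ := sInf (spectrum ℝ X)

end QDiv

end

open scoped ENNReal ComplexOrder

namespace QDiv

open Matrix MeasureTheory Filter Topology

/-! ### Traces of positive parts of Hermitian matrices. -/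

section Trace

variable {n : Type*} [Fintype n] [DecidableEq n]

/-! Both `fDiv f` and `chiSq` integrate the same hockey-stick terms, with weights `f''` and `2`. A
term is nonzero only where its argument of `f''` (`γ` or `γ⁻¹`) lies in `ratioInterval`, so `f''` is
there between `kappaDown` and `kappaUp`; this gives the first two bounds pointwise. For the third,
let `A = ρ - σ` have eigenvalues `aᵢ` and let `σ ≥ c > 0`. For `γ ≥ 1`, `ρ - γσ ≤ A - (γ-1)c` and `σ
- γρ ≤ -γA - (γ-1)c`. Since the trace of the positive part is monotone, scalar sums bound the
integrand, and integrating them gives `χ² ≤ ∑ aᵢ² / c` (`chiSq_le_sum_sq`). As `Tr A = 0`, the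
positive and the negative `aᵢ` each have total modulus `E_1`, hence `χ² ≤ 2 E_1² / c`. -/

theorem trace_cfc_re {X : Matrix n n ℂ} (hX : X.IsHermitian) (g : ℝ → ℝ) :
    (cfc g X).trace.re = ∑ i, g (hX.eigenvalues i) := by
  rw [hX.cfc_eq, IsHermitian.cfc, Unitary.conjStarAlgAut_apply, trace_mul_comm, ← mul_assoc]
  simp [trace_diagonal]

theorem posSemidef_cfc {X : Matrix n n ℂ} {g : ℝ → ℝ} (hg : ∀ x ∈ spectrum ℝ X, 0 ≤ g x) :
    (cfc g X).PosSemidef := by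
  open scoped MatrixOrder in
  exact nonneg_iff_posSemidef.1 (cfc_nonneg hg)

theorem matPosPart_posSemidef (X : Matrix n n ℂ) : (matPosPart X).PosSemidef :=
  posSemidef_cfc fun _ _ => le_max_right _ _

/-- Among the positive semidefinite `Y ≥ X`, the positive part of `X` has the smallest trace. -/
theorem trace_matPosPart_le {X Y : Matrix n n ℂ} (hX : X.IsHermitian) (hY : Y.PosSemidef)
    (hXY : (Y - X).PosSemidef) : (matPosPart X).trace.re ≤ Y.trace.re := by
  set U : Matrix n n ℂ := (hX.eigenvectorUnitary : Matrix n n ℂ)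
  have hUU : U * Uᴴ = 1 := Unitary.coe_mul_star_self hX.eigenvectorUnitary
  have hD : Uᴴ * X * U = diagonal (RCLike.ofReal ∘ hX.eigenvalues) := by
    have := hX.conjStarAlgAut_star_eigenvectorUnitary
    rw [Unitary.conjStarAlgAut_apply] at this
    simpa [star_eq_conjTranspose] using this
  have htr : Y.trace.re = ∑ i, ((Uᴴ * Y * U) i i).re := by
    rw [← Complex.re_sum]
    change _ = (trace (Uᴴ * Y * U)).re
    rw [trace_mul_comm, ← mul_assoc, hUU, one_mul]
  rw [matPosPart, trace_cfc_re hX, htr]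
  -- In an eigenbasis of `X`, each diagonal entry of `Y` dominates both the eigenvalue and `0`.
  refine Finset.sum_le_sum fun i _ => max_le ?_ ?_
  · have h := (Complex.nonneg_iff.1 ((hXY.conjTranspose_mul_mul_same U).diag_nonneg (i := i))).1
    rw [mul_sub, sub_mul, hD] at h
    simpa using h
  · exact (Complex.nonneg_iff.1 ((hY.conjTranspose_mul_mul_same U).diag_nonneg (i := i))).1

theorem trace_matPosPart_mono {X Y : Matrix n n ℂ} (hX : X.IsHermitian) (hY : Y.IsHermitian)
    (hXY : (Y - X).PosSemidef) : (matPosPart X).trace.re ≤ (matPosPart Y).trace.re := by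
  refine trace_matPosPart_le hX (matPosPart_posSemidef Y) ?_
  have h : (matPosPart Y - Y).PosSemidef := by
    have : matPosPart Y - Y = cfc (fun x : ℝ => max x 0 - x) Y := by
      rw [cfc_sub (fun x : ℝ => max x 0) (fun x => x) Y, cfc_id' ℝ Y hY.isSelfAdjoint]
      rfl
    rw [this]
    exact posSemidef_cfc fun x _ => sub_nonneg.2 (le_max_left _ _)
  simpa using h.add hXY

theorem posSemidef_sub_lambdaMin {X : Matrix n n ℂ} (hX : X.IsHermitian) :
    (X - lambdaMin X • (1 : Matrix n n ℂ)).PosSemidef := by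
  have : X - lambdaMin X • (1 : Matrix n n ℂ) = cfc (fun x : ℝ => x - lambdaMin X) X := by
    rw [cfc_sub (fun x : ℝ => x) (fun _ => lambdaMin X) X, cfc_id' ℝ X hX.isSelfAdjoint,
      cfc_const _ X hX.isSelfAdjoint, Algebra.algebraMap_eq_smul_one]
  rw [this]
  exact posSemidef_cfc fun x hx => sub_nonneg.2
    (csInf_le (Matrix.finite_real_spectrum (A := X)).bddBelow hx)

/-- If `X ≤ p A + q`, then `Tr X₊` is at most `Tr (p A + q)₊`. -/
theorem trace_matPosPart_le_sum {A X : Matrix n n ℂ} (hA : A.IsHermitian) (hX : X.IsHermitian)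
    {p q : ℝ} (h : (p • A + q • (1 : Matrix n n ℂ) - X).PosSemidef) :
    (matPosPart X).trace.re ≤ ∑ i, max (p * hA.eigenvalues i + q) 0 := by
  rw [← trace_cfc_re hA (fun x => max (p * x + q) 0)]
  refine trace_matPosPart_le hX (posSemidef_cfc fun _ _ => le_max_right _ _) ?_
  have e : cfc (fun x : ℝ => max (p * x + q) 0 - (p * x + q)) A =
      cfc (fun x : ℝ => max (p * x + q) 0) A - (p • A + q • (1 : Matrix n n ℂ)) := by
    rw [cfc_sub (fun x : ℝ => max (p * x + q) 0) (fun x => p * x + q) A,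
      cfc_add A (fun x : ℝ => p * x) (fun _ => q), cfc_const_mul_id p A hA.isSelfAdjoint,
      cfc_const _ A hA.isSelfAdjoint, Algebra.algebraMap_eq_smul_one]
  have h1 : (cfc (fun x : ℝ => max (p * x + q) 0 - (p * x + q)) A).PosSemidef :=
    posSemidef_cfc fun x _ => sub_nonneg.2 (le_max_left _ _)
  rw [e] at h1
  simpa using h1.add h

theorem trace_re_eq_sum_eigenvalues {X : Matrix n n ℂ} (hX : X.IsHermitian) :
    X.trace.re = ∑ i, hX.eigenvalues i := by
  simpa [cfc_id' ℝ X hX.isSelfAdjoint] using trace_cfc_re hX (fun x => x)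

end Trace

/-! ### Hockey-stick divergences: eigenvalue bounds and support. -/

section HockeyStick

variable {n : Type*} [Fintype n] [DecidableEq n] {ρ σ : Matrix n n ℂ}

omit [Fintype n] [DecidableEq n] in
theorem isHermitian_sub_smul (hρ : ρ.IsHermitian) (hσ : σ.IsHermitian) (γ : ℝ) :
    (ρ - γ • σ).IsHermitian :=
  hρ.sub (hσ.smul (IsSelfAdjoint.all γ))

theorem hockeyStick_nonneg (γ : ℝ) (ρ σ : Matrix n n ℂ) : 0 ≤ hockeyStick γ ρ σ :=
  (Complex.nonneg_iff.1 (matPosPart_posSemidef _).trace_nonneg).1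

theorem hockeyStick_antitone (hρ : ρ.IsHermitian) (hσ : σ.PosSemidef) :
    Antitone fun γ => hockeyStick γ ρ σ := by
  intro γ γ' h
  refine trace_matPosPart_mono (isHermitian_sub_smul hρ hσ.1 _) (isHermitian_sub_smul hρ hσ.1 _) ?_
  convert hσ.smul (sub_nonneg.2 h) using 1
  rw [sub_smul]
  abel

theorem hockeyStick_eq_zero (hρ : ρ.IsHermitian) (hσ : σ.IsHermitian) {γ : ℝ}
    (h : (γ • σ - ρ).PosSemidef) : hockeyStick γ ρ σ = 0 := by
  refine le_antisymm ?_ (hockeyStick_nonneg _ _ _)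
  rw [hockeyStick]
  simpa using trace_matPosPart_le (isHermitian_sub_smul hρ hσ γ) PosSemidef.zero
    (by simpa using h)

theorem hockeyStick_le_sum (hρ : ρ.IsHermitian) (hσ : σ.IsHermitian) (hA : (ρ - σ).IsHermitian)
    {c : ℝ} (hc : (σ - c • (1 : Matrix n n ℂ)).PosSemidef) {γ : ℝ} (hγ : 1 ≤ γ) :
    hockeyStick γ ρ σ ≤ ∑ i, max (hA.eigenvalues i - (γ - 1) * c) 0 := by
  have h := trace_matPosPart_le_sum hA (isHermitian_sub_smul hρ hσ γ)
    (p := 1) (q := -((γ - 1) * c)) (by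
      convert hc.smul (sub_nonneg.2 hγ) using 1
      module)
  rw [hockeyStick]
  simpa [← sub_eq_add_neg] using h

/-- Pulling out `γ` leaves a function of `1 - γ⁻¹`, whose derivative `γ⁻²` is exactly the remaining
weight `γ⁻³ · γ` in `chiSq`. -/
theorem hockeyStick_swap_le_sum (hρ : ρ.IsHermitian) (hσ : σ.IsHermitian)
    (hA : (ρ - σ).IsHermitian) {c : ℝ} (hc : (σ - c • (1 : Matrix n n ℂ)).PosSemidef) {γ : ℝ}
    (hγ : 1 ≤ γ) :
    hockeyStick γ σ ρ ≤ γ * ∑ i, max (-hA.eigenvalues i - (1 - γ⁻¹) * c) 0 := by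
  have hγ0 : 0 < γ := one_pos.trans_le hγ
  have h := trace_matPosPart_le_sum hA (isHermitian_sub_smul hσ hρ γ)
    (p := -γ) (q := -((γ - 1) * c)) (by
      convert hc.smul (sub_nonneg.2 hγ) using 1
      module)
  refine h.trans (le_of_eq ?_)
  rw [Finset.mul_sum]
  refine Finset.sum_congr rfl fun i _ => ?_
  rw [mul_max_of_nonneg _ _ hγ0.le, mul_zero]
  congr 1
  field_simp
  ring

theorem hockeyStick_one_eq_sum (hA : (ρ - σ).IsHermitian) :
    hockeyStick 1 ρ σ = ∑ i, max (hA.eigenvalues i) 0 := by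
  rw [hockeyStick, one_smul, matPosPart, trace_cfc_re hA]

theorem hockeyStick_one_eq_sum_neg (hρ : IsState ρ) (hσ : IsState σ)
    (hA : (ρ - σ).IsHermitian) :
    hockeyStick 1 ρ σ = ∑ i, max (-hA.eigenvalues i) 0 := by
  have h0 : ∑ i, hA.eigenvalues i = 0 := by
    rw [← trace_re_eq_sum_eigenvalues, trace_sub, hρ.trace_eq_one, hσ.trace_eq_one, sub_self,
      Complex.zero_re]
  rw [hockeyStick_one_eq_sum hA, ← sub_eq_zero, ← Finset.sum_sub_distrib]
  refine Eq.trans ?_ h0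
  refine Finset.sum_congr rfl fun i _ => ?_
  rcases le_total (hA.eigenvalues i) 0 with h | h
  · rw [max_eq_right h, max_eq_left (neg_nonneg.2 h), zero_sub, neg_neg]
  · rw [max_eq_left h, max_eq_right (neg_nonpos.2 h), sub_zero]

-- Taking traces in `ρ ≤ e^x σ` gives `1 ≤ e^x`. Hence `1` lies between the endpoints of
-- `ratioInterval`.
omit [DecidableEq n] in
theorem dMax_nonneg (hρ : IsState ρ) (hσ : IsState σ) : 0 ≤ dMax ρ σ := by
  refine le_sInf ?_
  rintro _ ⟨x, rfl, hx⟩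
  have h := (Complex.nonneg_iff.1 hx.trace_nonneg).1
  rw [trace_sub, trace_smul, hρ.trace_eq_one, hσ.trace_eq_one] at h
  simp only [Complex.sub_re, Complex.smul_re, Complex.one_re, smul_eq_mul, mul_one,
    sub_nonneg] at h
  exact_mod_cast Real.one_le_exp_iff.1 h

/-- If `ρ ≤ e^x σ` with `e^x ≤ γ`, then `E_γ` vanishes by monotonicity in `γ`. -/
theorem le_exp_dMax (hρ : ρ.IsHermitian) (hσ : σ.PosSemidef) {γ : ℝ}
    (h : hockeyStick γ ρ σ ≠ 0) : ENNReal.ofReal γ ≤ EReal.exp (dMax ρ σ) := by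
  rcases le_or_gt γ 0 with h0 | h0
  · simp [ENNReal.ofReal_of_nonpos h0]
  rw [← Real.exp_log h0, ← EReal.exp_coe, EReal.exp_le_exp_iff]
  refine le_sInf ?_
  rintro _ ⟨x, rfl, hx⟩
  rw [EReal.coe_le_coe_iff]
  by_contra! hlt
  have hle : Real.exp x ≤ γ := by
    rw [← Real.exp_log h0]
    exact Real.exp_le_exp.2 hlt.le
  refine h (le_antisymm ?_ (hockeyStick_nonneg _ _ _))
  exact (hockeyStick_antitone hρ hσ hle).trans (hockeyStick_eq_zero hρ hσ.1 hx).le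

theorem mem_ratioInterval (hρ : IsState ρ) (hσ : IsState σ) {γ : ℝ} (hγ : 1 < γ)
    (h : hockeyStick γ ρ σ ≠ 0) : γ ∈ ratioInterval ρ σ := by
  refine ⟨by linarith, ?_, le_exp_dMax hρ.posSemidef.1 hσ.posSemidef h⟩
  calc EReal.exp (-dMax σ ρ) ≤ 1 := by simpa using dMax_nonneg hσ hρ
    _ ≤ ENNReal.ofReal γ := ENNReal.one_le_ofReal.2 hγ.le

theorem inv_mem_ratioInterval (hρ : IsState ρ) (hσ : IsState σ) {γ : ℝ} (hγ : 1 < γ)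
    (h : hockeyStick γ σ ρ ≠ 0) : γ⁻¹ ∈ ratioInterval ρ σ := by
  have h0 : 0 < γ := by linarith
  refine ⟨by positivity, ?_, ?_⟩
  · rw [EReal.exp_neg, ENNReal.ofReal_inv_of_pos h0, ENNReal.inv_le_inv]
    exact le_exp_dMax hσ.posSemidef.1 hρ.posSemidef h
  · calc ENNReal.ofReal γ⁻¹ ≤ 1 := by
          rw [ENNReal.ofReal_le_one]
          exact inv_le_one_of_one_le₀ hγ.le
      _ ≤ EReal.exp (dMax ρ σ) := by simpa using dMax_nonneg hρ hσ

omit [Fintype n] [DecidableEq n] in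
theorem le_kappaUp (f : ℝ → ℝ) {γ : ℝ} (h : γ ∈ ratioInterval ρ σ) :
    ENNReal.ofReal (deriv (deriv f) γ) ≤ kappaUp f ρ σ := by
  refine le_trans (le_of_eq ?_) (le_iSup₂_of_le 1 (by simp) (le_iSup₂ γ h))
  simp

omit [Fintype n] [DecidableEq n] in
theorem kappaDown_le (f : ℝ → ℝ) {γ : ℝ} (h : γ ∈ ratioInterval ρ σ) :
    kappaDown f ρ σ ≤ ENNReal.ofReal (deriv (deriv f) γ) := by
  refine (iInf₂_le_of_le 1 (by simp) (iInf₂_le γ h)).trans (le_of_eq ?_)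
  simp

end HockeyStick

theorem MemF.deriv2_nonneg {f : ℝ → ℝ} (hf : MemF f) {x : ℝ} (hx : 0 < x) :
    0 ≤ deriv (deriv f) x := by
  have hmono : MonotoneOn (deriv f) (Set.Ioi 0) := hf.convexOn.monotoneOn_deriv fun y hy =>
    (hf.differentiableOn y hy).differentiableAt (Ioi_mem_nhds hy)
  have := hmono.derivWithin_nonneg (x := x)
  rwa [derivWithin_of_mem_nhds (Ioi_mem_nhds hx)] at this

/-! ### Comparison of `fDiv` with `chiSq`, and bounds on `chiSq`. -/

section ChiSq

variable {n : Type*} [Fintype n] [DecidableEq n] {ρ σ : Matrix n n ℂ}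

theorem chiSq_eq_lintegral (ρ σ : Matrix n n ℂ) :
    chiSq ρ σ = 2 * ∫⁻ γ in Set.Ioi (1 : ℝ), (ENNReal.ofReal (hockeyStick γ ρ σ) +
      ENNReal.ofReal ((γ ^ 3)⁻¹ * hockeyStick γ σ ρ)) := by
  have h1 : deriv (fun x : ℝ => (x ^ (2 : ℝ) - 1) / (2 - 1)) = fun x => 2 * x := by
    funext x
    have : (fun x : ℝ => (x ^ (2 : ℝ) - 1) / (2 - 1)) = fun x => x ^ 2 - 1 := by
      funext y
      norm_num
    rw [this]
    simp
  have h2 : deriv (fun x : ℝ => 2 * x) = fun _ => 2 := by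
    funext x
    simp
  rw [chiSq, hellinger, fDiv, ← lintegral_const_mul' _ _ (by simp)]
  refine setLIntegral_congr_fun measurableSet_Ioi fun γ hγ => ?_
  have hγ0 : (0 : ℝ) < γ := lt_trans one_pos hγ
  have h := hockeyStick_nonneg γ ρ σ
  have h' := hockeyStick_nonneg γ σ ρ
  simp only [h1, h2]
  rw [← ENNReal.ofReal_add h (by positivity), ← ENNReal.ofReal_ofNat 2,
    ← ENNReal.ofReal_mul (by norm_num)]
  congr 1
  ring

theorem fDiv_eq_lintegral {f : ℝ → ℝ} (hf : MemF f) (ρ σ : Matrix n n ℂ) :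
    fDiv f ρ σ = ∫⁻ γ in Set.Ioi (1 : ℝ),
      (ENNReal.ofReal (deriv (deriv f) γ) * ENNReal.ofReal (hockeyStick γ ρ σ) +
        ENNReal.ofReal (deriv (deriv f) γ⁻¹) *
          ENNReal.ofReal ((γ ^ 3)⁻¹ * hockeyStick γ σ ρ)) := by
  refine setLIntegral_congr_fun measurableSet_Ioi fun γ hγ => ?_
  have hγ0 : (0 : ℝ) < γ := lt_trans one_pos hγ
  have h := hockeyStick_nonneg γ ρ σ
  have h' := hockeyStick_nonneg γ σ ρ
  have d := hf.deriv2_nonneg hγ0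
  have d' := hf.deriv2_nonneg (inv_pos.2 hγ0)
  rw [← ENNReal.ofReal_mul d, ← ENNReal.ofReal_mul d',
    ← ENNReal.ofReal_add (by positivity) (by positivity)]
  congr 1
  ring

theorem kappaDown_mul_chiSq_le_fDiv (hρ : IsState ρ) (hσ : IsState σ) {f : ℝ → ℝ}
    (hf : MemF f) : kappaDown f ρ σ / 2 * chiSq ρ σ ≤ fDiv f ρ σ := by
  rw [chiSq_eq_lintegral, fDiv_eq_lintegral hf, ← mul_assoc,
    ENNReal.div_mul_cancel (by simp) (by simp)]
  -- This direction needs neither measurability nor a finite constant; the upper bound needs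
  -- measurability, which antitonicity provides.
  refine (lintegral_const_mul_le _ _).trans (setLIntegral_mono' measurableSet_Ioi fun γ hγ => ?_)
  rw [mul_add]
  gcongr ?_ + ?_
  · by_cases h : hockeyStick γ ρ σ = 0
    · simp [h]
    · gcongr
      exact kappaDown_le f (mem_ratioInterval hρ hσ hγ h)
  · by_cases h : hockeyStick γ σ ρ = 0
    · simp [h]
    · gcongr
      exact kappaDown_le f (inv_mem_ratioInterval hρ hσ hγ h)

theorem fDiv_le_kappaUp_mul_chiSq (hρ : IsState ρ) (hσ : IsState σ) {f : ℝ → ℝ}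
    (hf : MemF f) : fDiv f ρ σ ≤ kappaUp f ρ σ / 2 * chiSq ρ σ := by
  have m : Measurable fun γ => hockeyStick γ ρ σ :=
    (hockeyStick_antitone hρ.posSemidef.1 hσ.posSemidef).measurable
  have m' : Measurable fun γ => hockeyStick γ σ ρ :=
    (hockeyStick_antitone hσ.posSemidef.1 hρ.posSemidef).measurable
  rw [chiSq_eq_lintegral, fDiv_eq_lintegral hf, ← mul_assoc,
    ENNReal.div_mul_cancel (by simp) (by simp), ← lintegral_const_mul _ (by fun_prop)]
  refine setLIntegral_mono' measurableSet_Ioi fun γ hγ => ?_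
  rw [mul_add]
  gcongr ?_ + ?_
  · by_cases h : hockeyStick γ ρ σ = 0
    · simp [h]
    · gcongr
      exact le_kappaUp f (mem_ratioInterval hρ hσ hγ h)
  · by_cases h : hockeyStick γ σ ρ = 0
    · simp [h]
    · gcongr
      exact le_kappaUp f (inv_mem_ratioInterval hρ hσ hγ h)

/-- Squaring removes the kink at `0`, so the antiderivative in `chiSq_le_sum_sq` is differentiable
everywhere on `[1, ∞)`. -/
theorem hasDerivAt_max_zero_sq (x : ℝ) :
    HasDerivAt (fun y : ℝ => max y 0 ^ 2) (2 * max x 0) x := by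
  rcases lt_trichotomy x 0 with h | rfl | h
  · rw [max_eq_right h.le, mul_zero]
    refine (hasDerivAt_const x (0 : ℝ)).congr_of_eventuallyEq ?_
    filter_upwards [Iio_mem_nhds h] with y hy
    simp [max_eq_right (le_of_lt (Set.mem_Iio.1 hy))]
  · rw [max_self, mul_zero, hasDerivAt_iff_isLittleO_nhds_zero]
    have h : (fun y : ℝ => y ^ 2) =o[𝓝 0] fun y : ℝ => y := by
      simpa using Asymptotics.isLittleO_pow_pow (𝕜 := ℝ) (m := 1) (n := 2) (by norm_num)
    refine (Asymptotics.IsBigO.of_bound 1 (Eventually.of_forall fun y => ?_)).trans_isLittleO h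
    simp only [zero_add, max_self, smul_zero, sub_zero, one_mul, norm_pow, Real.norm_eq_abs,
      ne_eq, OfNat.ofNat_ne_zero, not_false_eq_true, zero_pow]
    refine pow_le_pow_left₀ (abs_nonneg _) ?_ 2
    rw [abs_of_nonneg (le_max_right y 0)]
    exact max_le (le_abs_self y) (abs_nonneg y)
  · rw [max_eq_left h.le]
    have := hasDerivAt_pow 2 x
    simp only [Nat.cast_ofNat, Nat.add_one_sub_one, pow_one] at this
    refine this.congr_of_eventuallyEq ?_
    filter_upwards [Ioi_mem_nhds h] with y hy
    rw [max_eq_left (le_of_lt hy)]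

/-- `χ² ≤ c⁻¹ ∑ aᵢ²` when `σ ≥ c > 0` and the `aᵢ` are the eigenvalues of `ρ - σ`. -/
theorem chiSq_le_sum_sq (hρ : ρ.IsHermitian) (hσ : σ.IsHermitian) (hA : (ρ - σ).IsHermitian)
    {c : ℝ} (hc0 : 0 < c) (hc : (σ - c • (1 : Matrix n n ℂ)).PosSemidef) :
    chiSq ρ σ ≤ ENNReal.ofReal
      ((∑ i, (max (hA.eigenvalues i) 0 ^ 2 + max (-hA.eigenvalues i) 0 ^ 2)) / c) := by
  set a := hA.eigenvalues
  set h : ℝ → ℝ := fun γ => ∑ i, (max (a i - (γ - 1) * c) 0 +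
    (γ ^ 2)⁻¹ * max (-a i - (1 - γ⁻¹) * c) 0) with hh
  -- An explicit antiderivative of `h`.
  set g : ℝ → ℝ := fun γ => ∑ i, (-(2 * c)⁻¹) * (max (a i - (γ - 1) * c) 0 ^ 2 +
    max (-a i - (1 - γ⁻¹) * c) 0 ^ 2) with hg
  have hgd : ∀ x ∈ Set.Ici (1 : ℝ), HasDerivAt g (h x) x := by
    intro x hx
    have hx0 : x ≠ 0 := (lt_of_lt_of_le one_pos hx).ne'
    refine HasDerivAt.fun_sum fun i _ => ?_
    have e1 : HasDerivAt (fun γ : ℝ => a i - (γ - 1) * c) (-c) x := by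
      simpa using (((hasDerivAt_id x).sub_const 1).mul_const c).const_sub (a i)
    have e2 : HasDerivAt (fun γ : ℝ => -a i - (1 - γ⁻¹) * c) (-((x ^ 2)⁻¹ * c)) x := by
      simpa using (((hasDerivAt_inv hx0).const_sub 1).mul_const c).const_sub (-a i)
    have e := (((hasDerivAt_max_zero_sq _).comp x e1).add
      ((hasDerivAt_max_zero_sq _).comp x e2)).const_mul (-(2 * c)⁻¹)
    refine e.congr_deriv ?_
    field_simp
    ring
  have hpos : ∀ x ∈ Set.Ioi (1 : ℝ), 0 ≤ h x := fun x _ =>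
    Finset.sum_nonneg fun i _ => by positivity
  have hlim : Tendsto g atTop
      (𝓝 (∑ i, (-(2 * c)⁻¹) * (0 ^ 2 + max (-a i - (1 - 0) * c) 0 ^ 2))) := by
    refine tendsto_finsetSum _ fun i _ => (Tendsto.add (Tendsto.pow ?_ 2)
      (Tendsto.pow (Tendsto.max (tendsto_const_nhds.sub
        ((tendsto_const_nhds.sub tendsto_inv_atTop_zero).mul_const c)) tendsto_const_nhds)
          2)).const_mul _
    refine tendsto_const_nhds.congr' ?_
    filter_upwards [eventually_ge_atTop (a i / c + 1)] with γ hγ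
    have : a i ≤ (γ - 1) * c := by
      rw [← div_le_iff₀ hc0]
      linarith
    exact (max_eq_right (by linarith)).symm
  have hint := integrableOn_Ioi_deriv_of_nonneg' hgd hpos hlim
  have hval := integral_Ioi_of_hasDerivAt_of_nonneg' hgd hpos hlim
  have hpt : ∀ γ ∈ Set.Ioi (1 : ℝ), ENNReal.ofReal (hockeyStick γ ρ σ) +
      ENNReal.ofReal ((γ ^ 3)⁻¹ * hockeyStick γ σ ρ) ≤ ENNReal.ofReal (h γ) := by
    intro γ hγ
    have hγ1 : 1 < γ := hγ
    have hγ0 : 0 < γ := lt_trans one_pos hγ1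
    have b1 := hockeyStick_le_sum hρ hσ hA hc hγ1.le
    have b2 := hockeyStick_swap_le_sum hρ hσ hA hc hγ1.le
    rw [← ENNReal.ofReal_add (hockeyStick_nonneg _ _ _)
      (mul_nonneg (by positivity) (hockeyStick_nonneg _ _ _))]
    refine ENNReal.ofReal_le_ofReal ?_
    rw [hh]
    simp only
    rw [Finset.sum_add_distrib, ← Finset.mul_sum]
    refine add_le_add b1 ?_
    calc (γ ^ 3)⁻¹ * hockeyStick γ σ ρ
        ≤ (γ ^ 3)⁻¹ * (γ * ∑ i, max (-a i - (1 - γ⁻¹) * c) 0) := by gcongr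
      _ = _ := by field_simp
  rw [chiSq_eq_lintegral]
  calc 2 * ∫⁻ γ in Set.Ioi (1 : ℝ), (ENNReal.ofReal (hockeyStick γ ρ σ) +
        ENNReal.ofReal ((γ ^ 3)⁻¹ * hockeyStick γ σ ρ))
      ≤ 2 * ∫⁻ γ in Set.Ioi (1 : ℝ), ENNReal.ofReal (h γ) := by
        gcongr 2 * ?_
        exact setLIntegral_mono' measurableSet_Ioi hpt
    _ = ENNReal.ofReal (2 * ∫ γ in Set.Ioi (1 : ℝ), h γ) := by
        rw [← ofReal_integral_eq_lintegral_ofReal hint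
          ((ae_restrict_iff' measurableSet_Ioi).2 (Eventually.of_forall hpos)),
          ENNReal.ofReal_mul (by norm_num), ENNReal.ofReal_ofNat]
    _ ≤ _ := by
        refine ENNReal.ofReal_le_ofReal ?_
        rw [hval]
        -- The limit of `g` at infinity is nonpositive and can be dropped, leaving `-g 1`.
        have hl : ∑ i, (-(2 * c)⁻¹) * (0 ^ 2 + max (-a i - (1 - 0) * c) 0 ^ 2) ≤ 0 :=
          Finset.sum_nonpos fun i _ => by
            rw [neg_mul]
            exact neg_nonpos.2 (by positivity)
        have hg1 : g 1 = -(2 * c)⁻¹ * ∑ i, (max (a i) 0 ^ 2 + max (-a i) 0 ^ 2) := by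
          simp [hg, Finset.mul_sum]
        rw [hg1]
        have : 2 * -(-(2 * c)⁻¹ * ∑ i, (max (a i) 0 ^ 2 + max (-a i) 0 ^ 2)) =
          (∑ i, (max (a i) 0 ^ 2 + max (-a i) 0 ^ 2)) / c := by field_simp
        linarith

theorem chiSq_le_hockeyStick_sq (hρ : IsState ρ) (hσ : IsState σ) {c : ℝ} (hc0 : 0 < c)
    (hc : (σ - c • (1 : Matrix n n ℂ)).PosSemidef) :
    chiSq ρ σ ≤ ENNReal.ofReal (2 * hockeyStick 1 ρ σ ^ 2 / c) := by
  have hA : (ρ - σ).IsHermitian := hρ.posSemidef.1.sub hσ.posSemidef.1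
  refine (chiSq_le_sum_sq hρ.posSemidef.1 hσ.posSemidef.1 hA hc0 hc).trans
    (ENNReal.ofReal_le_ofReal ?_)
  gcongr
  rw [Finset.sum_add_distrib, two_mul]
  refine add_le_add ?_ ?_
  · rw [hockeyStick_one_eq_sum hA]
    exact Finset.sum_sq_le_sq_sum_of_nonneg fun _ _ => le_max_right _ _
  · rw [hockeyStick_one_eq_sum_neg hρ hσ hA]
    exact Finset.sum_sq_le_sq_sum_of_nonneg fun _ _ => le_max_right _ _

/-- `χ²` vanishes when `E_1` does. -/
theorem chiSq_eq_zero (hρ : IsState ρ) (hσ : IsState σ) (h : hockeyStick 1 ρ σ = 0) :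
    chiSq ρ σ = 0 := by
  have hA : (ρ - σ).IsHermitian := hρ.posSemidef.1.sub hσ.posSemidef.1
  have h' : hockeyStick 1 σ ρ ≤ 0 := by
    -- At `γ = 1` the term with `c` disappears, so `c = 0` is enough.
    have := hockeyStick_swap_le_sum hρ.posSemidef.1 hσ.posSemidef.1 hA (c := 0)
      (by simpa using hσ.posSemidef) le_rfl
    simpa [← hockeyStick_one_eq_sum_neg hρ hσ hA, h] using this
  rw [chiSq_eq_lintegral, mul_eq_zero]
  right
  rw [← lintegral_zero (μ := volume.restrict (Set.Ioi (1 : ℝ)))]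
  refine setLIntegral_congr_fun measurableSet_Ioi fun γ hγ => ?_
  have hγ1 : 1 ≤ γ := le_of_lt hγ
  have e1 : hockeyStick γ ρ σ = 0 := le_antisymm
    ((hockeyStick_antitone hρ.posSemidef.1 hσ.posSemidef hγ1).trans h.le)
    (hockeyStick_nonneg _ _ _)
  have e2 : hockeyStick γ σ ρ = 0 := le_antisymm
    ((hockeyStick_antitone hσ.posSemidef.1 hρ.posSemidef hγ1).trans h')
    (hockeyStick_nonneg _ _ _)
  simp [e1, e2]

end ChiSq

end QDiv

theorem mainTheorem9 {n : Type*} [Fintype n] [DecidableEq n]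
    (ρ σ : Matrix n n ℂ) (hρ : QDiv.IsState ρ) (hσ : QDiv.IsState σ)
    (f : ℝ → ℝ) (hf : QDiv.MemF f) :
    QDiv.kappaDown f ρ σ / 2 * QDiv.chiSq ρ σ ≤ QDiv.fDiv f ρ σ ∧
    QDiv.fDiv f ρ σ ≤ QDiv.kappaUp f ρ σ / 2 * QDiv.chiSq ρ σ ∧
    QDiv.fDiv f ρ σ ≤
      2 * QDiv.kappaUp f ρ σ * ENNReal.ofReal (QDiv.hockeyStick 1 ρ σ) ^ 2 /
        ENNReal.ofReal (QDiv.lambdaMin σ) := by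
  have hup := QDiv.fDiv_le_kappaUp_mul_chiSq hρ hσ hf
  refine ⟨QDiv.kappaDown_mul_chiSq_le_fDiv hρ hσ hf, hup, ?_⟩
  rcases lt_or_ge 0 (QDiv.lambdaMin σ) with hl | hl
  · refine hup.trans ?_
    have hchi := QDiv.chiSq_le_hockeyStick_sq hρ hσ hl
      (QDiv.posSemidef_sub_lambdaMin hσ.posSemidef.1)
    rw [ENNReal.ofReal_div_of_pos hl, ENNReal.ofReal_mul (by norm_num), ENNReal.ofReal_ofNat,
      ENNReal.ofReal_pow (QDiv.hockeyStick_nonneg _ _ _)] at hchi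
    calc QDiv.kappaUp f ρ σ / 2 * QDiv.chiSq ρ σ
        ≤ QDiv.kappaUp f ρ σ / 2 * (2 * ENNReal.ofReal (QDiv.hockeyStick 1 ρ σ) ^ 2 /
          ENNReal.ofReal (QDiv.lambdaMin σ)) := by gcongr
      _ = QDiv.kappaUp f ρ σ * ENNReal.ofReal (QDiv.hockeyStick 1 ρ σ) ^ 2 /
          ENNReal.ofReal (QDiv.lambdaMin σ) := by
        rw [← mul_div_assoc, ← mul_assoc, ENNReal.div_mul_cancel (by simp) (by simp)]
      -- The argument gives half the stated constant; the factor `2` is slack.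
      _ ≤ _ := by
        gcongr
        exact le_mul_of_one_le_left zero_le (by norm_num)
  -- The right side is `∞` unless its numerator vanishes; then `kappaUp = 0` or `χ² = 0`.
  · rw [ENNReal.ofReal_of_nonpos hl]
    by_cases h : 2 * QDiv.kappaUp f ρ σ * ENNReal.ofReal (QDiv.hockeyStick 1 ρ σ) ^ 2 = 0
    · refine hup.trans ?_
      rw [h]
      rcases mul_eq_zero.1 h with h | h
      · have : QDiv.kappaUp f ρ σ = 0 := by simpa using h
        simp [this]
      · have h' : QDiv.hockeyStick 1 ρ σ = 0 :=
          le_antisymm (by simpa using h) (QDiv.hockeyStick_nonneg _ _ _)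
        simp [QDiv.chiSq_eq_zero hρ hσ h']
    · rw [ENNReal.div_zero h]
      exact le_top
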